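/- Let $d,n\ge 1$ be integers, let $H$ be a Hermitian operator on $\mathbb{C}^d$, and let $$H_n=\sum_{i=1}^{n} I^{\otimes (i-1)}\otimes H\otimes I^{\otimes (n-i)}$$ be the corresponding non-interacting Hamiltonian on $(\mathbb{C}^d)^{\otimes n}$. Let $|\psi_0\rangle\in(\mathbb{C}^d)^{\otimes n}$ be an arbitrary unit vector, put $\psi_0=|\psi_0\rangle\langle\psi_0|$ and $\psi_t=e^{-itH_n}\,\psi_0\,e^{itH_n}$ for $t\in\mathbb{R}$, and let $D_{\mathrm{tr}}(\rho,\sigma)=\tfrac12\|\rho-\sigma\|_1$ denote the trace distance. For $\varepsilon>0$ define $$t_{\mathrm{exit}}(\varepsilon)=\inf\{t>0 : D_{\mathrm{tr}}(\psi_0,\psi_t)\ge\varepsilon\},\qquad t_{\mathrm{rec}}(\varepsilon)=\inf\{t>t_{\mathrm{exit}}(\varepsilon) : D_{\mathrm{tr}}(\psi_0,\psi_t)\le\varepsilon\},$$ with values in $[0,\infty]$ and $\inf\emptyset=\infty$. Then for every $\varepsilon>0$ $$t_{\mathrm{rec}}(\varepsilon)\le t_{\mathrm{exit}}(\varepsilon)\cdot\left(\frac{4\pi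 n}{\varepsilon}\right)^{d-1}.$$ In particular, the exponent depends only on the single-particle dimension $d$, not on the dimension $d^n$ of the $n$-particle space. -/

import Mathlib

open scoped Matrix

noncomputable section

/-! Exit and recurrence times of a trajectory `x : ℝ → X` in a space with distance `D`,
as extended reals: the infimum of the empty set is `⊤`. -/

/-- `inf {t > 0 | D(x₀, xₜ) ≥ ε}`, equal to `⊤` if the trajectory never leaves. -/
def exitTime {X : Type*} (D : X → X → ℝ) (x : ℝ → X) (ε : ℝ) : EReal :=
  sInf ((fun t : ℝ => (t : EReal)) '' {t : ℝ | 0 < t ∧ ε ≤ D (x 0) (x t)})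

/-- `inf {t > exit time | D(x₀, xₜ) ≤ ε}`, equal to `⊤` if there is no such time. -/
def recurrenceTime {X : Type*} (D : X → X → ℝ) (x : ℝ → X) (ε : ℝ) : EReal :=
  sInf ((fun t : ℝ => (t : EReal)) ''
    {t : ℝ | exitTime D x ε < (t : EReal) ∧ D (x 0) (x t) ≤ ε})

/-- The trace norm `‖A‖₁ = tr √(A† A)`, i.e. the sum of the singular values of `A`. -/
def traceNorm {m : Type*} [Fintype m] [DecidableEq m] (A : Matrix m m ℂ) : ℝ :=
  ∑ i, √((Matrix.isHermitian_conjTranspose_mul_self A).eigenvalues i)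

/-- The trace distance `½ ‖ρ - σ‖₁`. -/
def traceDistance {m : Type*} [Fintype m] [DecidableEq m] (ρ σ : Matrix m m ℂ) : ℝ :=
  (1 / 2) * traceNorm (ρ - σ)

/-- The rank-one projector `|ψ⟩⟨ψ|` of a vector `ψ`. -/
def pureState {m : Type*} [Fintype m] (ψ : EuclideanSpace ℂ m) : Matrix m m ℂ :=
  Matrix.of fun k l => ψ k * star (ψ l)

/-- The Hamiltonian evolution `ρₜ = e^{-iHt} ρ₀ e^{iHt}`. -/
def evolution {m : Type*} [Fintype m] [DecidableEq m] (H ρ₀ : Matrix m m ℂ) (t : ℝ) :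
    Matrix m m ℂ :=
  NormedSpace.exp ((-(Complex.I * (t : ℂ))) • H) * ρ₀ *
    NormedSpace.exp ((Complex.I * (t : ℂ)) • H)

/-- The tensor product operator `A₁ ⊗ ⋯ ⊗ Aₙ` on `(ℂ^d)^{⊗ n}`, written in the product basis
`|k₁⟩ ⊗ ⋯ ⊗ |kₙ⟩`, which is indexed by the functions `k : Fin n → Fin d`. -/
def tensorOperator {n d : ℕ} (A : Fin n → Matrix (Fin d) (Fin d) ℂ) :
    Matrix (Fin n → Fin d) (Fin n → Fin d) ℂ :=
  Matrix.of fun k l => ∏ j, A j (k j) (l j)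

/-- The non-interacting Hamiltonian `Hₙ = ∑ i, I ⊗ ⋯ ⊗ H ⊗ ⋯ ⊗ I`, with `H` in position `i`. -/
def freeHamiltonian (n : ℕ) {d : ℕ} (H : Matrix (Fin d) (Fin d) ℂ) :
    Matrix (Fin n → Fin d) (Fin n → Fin d) ℂ :=
  ∑ i : Fin n, tensorOperator (fun j => if j = i then H else 1)

end

open Matrix

/-! If `V` diagonalises `H`, then `V ⊗ ⋯ ⊗ V` diagonalises the free Hamiltonian, and each of its
energies is a sum of `n` single-particle energies. Up to a global phase, the dynamics therefore
depends only on the `d - 1` gaps `e i - e 0`. Dirichlet approximation, applied to the phases of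
these gaps over a time step `s`, gives `k ≤ (4πn/ε)^(d-1)` such that at time `k * s` each gap phase
is within `ε/n` of `2πℤ`, hence each `n`-particle phase is within `ε` of a common one. The overlap
with the initial state is then so close to modulus 1 that the trace distance is at most `ε`. Taking
`s` just above the exit time makes `k * s` a recurrence. -/

/-- Simultaneous Dirichlet approximation. -/
theorem exists_natCast_mul_sub_intCast_le {ι : Type*} [Fintype ι] (x : ι → ℝ) {M : ℕ}
    (hM : 0 < M) :
    ∃ k : ℕ, 1 ≤ k ∧ k ≤ M ^ Fintype.card ι ∧
      ∃ m : ι → ℤ, ∀ i, |(k : ℝ) * x i - m i| ≤ 1 / M := by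
  classical
  have hM' : (0 : ℝ) < M := by exact_mod_cast hM
  have hlt (y : ℝ) : ⌊(M : ℝ) * Int.fract y⌋₊ < M := by
    rw [Nat.floor_lt (by have := Int.fract_nonneg y; positivity)]
    nlinarith [Int.fract_lt_one y]
  -- Pigeonhole: `M ^ card ι + 1` multiples fall into `M ^ card ι` boxes of side `1 / M`.
  let f : ℕ → ι → Fin M := fun k i => ⟨⌊(M : ℝ) * Int.fract ((k : ℝ) * x i)⌋₊, hlt _⟩
  obtain ⟨a, ha, b, hb, hab, hf⟩ :=
    Finset.exists_ne_map_eq_of_card_lt_of_maps_to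
      (s := Finset.range (M ^ Fintype.card ι + 1)) (t := (Finset.univ : Finset (ι → Fin M)))
      (f := f) (by simp) (by intro _ _; simp)
  wlog hlt' : a < b generalizing a b
  · exact this b hb a ha hab.symm hf.symm (by omega)
  simp only [Finset.mem_range] at ha hb
  refine ⟨b - a, by omega, by omega, fun i => ⌊(b : ℝ) * x i⌋ - ⌊(a : ℝ) * x i⌋, fun i => ?_⟩
  have h : ⌊(M : ℝ) * Int.fract ((a : ℝ) * x i)⌋₊ = ⌊(M : ℝ) * Int.fract ((b : ℝ) * x i)⌋₊ :=
    congrArg Fin.val (congrFun hf i)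
  have key (y : ℝ) : (⌊(M : ℝ) * Int.fract y⌋₊ : ℝ) ≤ M * Int.fract y :=
    Nat.floor_le (by have := Int.fract_nonneg y; positivity)
  have h1 := key ((a : ℝ) * x i)
  have h2 := Nat.lt_floor_add_one ((M : ℝ) * Int.fract ((a : ℝ) * x i))
  have h3 := key ((b : ℝ) * x i)
  have h4 := Nat.lt_floor_add_one ((M : ℝ) * Int.fract ((b : ℝ) * x i))
  rw [h] at h1 h2
  have e : ((b - a : ℕ) : ℝ) * x i - ((⌊(b : ℝ) * x i⌋ - ⌊(a : ℝ) * x i⌋ : ℤ) : ℝ) =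
      Int.fract ((b : ℝ) * x i) - Int.fract ((a : ℝ) * x i) := by
    rw [Nat.cast_sub hlt'.le, Int.fract, Int.fract]; push_cast; ring
  rw [e, abs_le, ← neg_div, div_le_iff₀ hM', le_div_iff₀ hM']
  constructor <;> linarith

/-! ### Trace norm and trace distance of pure states -/

open scoped ComplexOrder in
theorem rank_conjTranspose_mul_self_complex {m : Type*} [Fintype m] (A : Matrix m m ℂ) :
    (Aᴴ * A).rank = A.rank :=
  rank_conjTranspose_mul_self A

theorem re_trace_conjTranspose_mul_self {m : Type*} [Fintype m] [DecidableEq m]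
    (A : Matrix m m ℂ) :
    (Aᴴ * A).trace.re = ∑ i, (isHermitian_conjTranspose_mul_self A).eigenvalues i := by
  rw [(isHermitian_conjTranspose_mul_self A).trace_eq_sum_eigenvalues]
  simp

/-- Cauchy–Schwarz over the nonzero singular values, whose number is the rank. -/
theorem traceNorm_sq_le_rank_mul_trace {m : Type*} [Fintype m] [DecidableEq m]
    (A : Matrix m m ℂ) : traceNorm A ^ 2 ≤ A.rank * (Aᴴ * A).trace.re := by
  set hA := isHermitian_conjTranspose_mul_self A
  have hnn (i) : 0 ≤ hA.eigenvalues i := eigenvalues_conjTranspose_mul_self_nonneg A i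
  have hsupp : traceNorm A =
      ∑ i ∈ Finset.univ.filter (fun i => hA.eigenvalues i ≠ 0), √(hA.eigenvalues i) := by
    rw [traceNorm, Finset.sum_filter_of_ne]
    intro i _ h h0
    exact h (by rw [h0, Real.sqrt_zero])
  have hcard : ((Finset.univ.filter (fun i => hA.eigenvalues i ≠ 0)).card : ℝ) = A.rank := by
    rw [← rank_conjTranspose_mul_self_complex, hA.rank_eq_card_non_zero_eigs, Fintype.card_subtype]
  rw [hsupp, re_trace_conjTranspose_mul_self, ← hcard]
  refine sq_sum_le_card_mul_sum_sq.trans ?_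
  gcongr
  simp_rw [Real.sq_sqrt (hnn _)]
  exact Finset.sum_le_sum_of_subset_of_nonneg (Finset.filter_subset _ _) fun i _ _ => hnn i

/-- The difference of two projectors has rank at most 2 and squared Hilbert–Schmidt norm `2 - 2|⟨v,
w⟩|²`. -/
theorem traceDistance_vecMulVec_sq_le {m : Type*} [Fintype m] [DecidableEq m] {v w : m → ℂ}
    (hv : star v ⬝ᵥ v = 1) (hw : star w ⬝ᵥ w = 1) :
    traceDistance (vecMulVec v (star v)) (vecMulVec w (star w)) ^ 2 ≤
      1 - Complex.normSq (star v ⬝ᵥ w) := by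
  have hr : (vecMulVec v (star v) - vecMulVec w (star w)).rank ≤ 2 := by
    have e : vecMulVec v (star v) - vecMulVec w (star w) =
        (of fun i => ![v i, w i]) * (of ![star v, -star w]) := by
      ext i j
      simp [mul_apply, Fin.sum_univ_two, vecMulVec_apply, sub_eq_add_neg]
    rw [e]
    exact (rank_mul_le_left _ _).trans ((rank_le_card_width _).trans_eq (Fintype.card_fin 2))
  have hwv : star w ⬝ᵥ v = star (star v ⬝ᵥ w) := by
    rw [← star_dotProduct]
  have ht : ((vecMulVec v (star v) - vecMulVec w (star w))ᴴ *
      (vecMulVec v (star v) - vecMulVec w (star w))).trace.re =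
      2 - 2 * Complex.normSq (star v ⬝ᵥ w) := by
    have e : ((vecMulVec v (star v) - vecMulVec w (star w))ᴴ *
      (vecMulVec v (star v) - vecMulVec w (star w))).trace =
      2 - 2 * ((star v ⬝ᵥ w) * star (star v ⬝ᵥ w)) := by
      simp only [conjTranspose_sub, conjTranspose_vecMulVec, star_star, sub_mul, mul_sub,
        vecMulVec_mul_vecMulVec, trace_sub, trace_vecMulVec, dotProduct_comm _ (star _),
        hv, hw, hwv, smul_eq_mul, dotProduct_smul]
      ring
    rw [e, ← starRingEnd_apply (star v ⬝ᵥ w), Complex.mul_conj]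
    simp
  have h := traceNorm_sq_le_rank_mul_trace (vecMulVec v (star v) - vecMulVec w (star w))
  have h0 : 0 ≤ 2 - 2 * Complex.normSq (star v ⬝ᵥ w) := by
    rw [← ht, re_trace_conjTranspose_mul_self]
    exact Finset.sum_nonneg fun i _ => eigenvalues_conjTranspose_mul_self_nonneg _ i
  rw [ht] at h
  have hr' : ((vecMulVec v (star v) - vecMulVec w (star w)).rank : ℝ) ≤ 2 := by exact_mod_cast hr
  rw [traceDistance, mul_pow]
  nlinarith [mul_le_mul_of_nonneg_right hr' h0]

/-! ### Evolution in an eigenbasis -/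

theorem pureState_eq_vecMulVec {m : Type*} [Fintype m] (ψ : EuclideanSpace ℂ m) :
    pureState ψ = vecMulVec ψ.ofLp (star ψ.ofLp) := rfl

theorem exp_smul_mul_diagonal_mul_conjTranspose {m : Type*} [Fintype m] [DecidableEq m]
    {W : Matrix m m ℂ} (hW : Wᴴ * W = 1) (E : m → ℂ) (a : ℂ) :
    NormedSpace.exp (a • (W * diagonal E * Wᴴ)) =
      W * diagonal (fun k => Complex.exp (a * E k)) * Wᴴ := by
  have hinv : W⁻¹ = Wᴴ := inv_eq_left_inv hW
  have hu : IsUnit W := IsUnit.of_mul_eq_one_right _ hW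
  have e : a • (W * diagonal E * Wᴴ) = W * diagonal (a • E) * W⁻¹ := by
    rw [hinv, diagonal_smul, mul_smul_comm, smul_mul_assoc]
  rw [e, exp_conj _ _ hu, exp_diagonal, hinv]
  congr 3
  ext k
  rw [Complex.exp_eq_exp_ℂ, Pi.coe_exp, Pi.smul_apply, smul_eq_mul]

theorem evolution_zero {m : Type*} [Fintype m] [DecidableEq m] (K ρ : Matrix m m ℂ) :
    evolution K ρ 0 = ρ := by
  simp [evolution, NormedSpace.exp_zero]

theorem evolution_pureState_eq {m : Type*} [Fintype m] [DecidableEq m]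
    {W : Matrix m m ℂ} (hW : Wᴴ * W = 1) (E : m → ℝ) (ψ : EuclideanSpace ℂ m) (t : ℝ) :
    evolution (W * diagonal (fun k => (E k : ℂ)) * Wᴴ) (pureState ψ) t =
      vecMulVec (W *ᵥ fun k => Complex.exp (-(Complex.I * t) * E k) * (Wᴴ *ᵥ ψ.ofLp) k)
        (star (W *ᵥ fun k => Complex.exp (-(Complex.I * t) * E k) * (Wᴴ *ᵥ ψ.ofLp) k)) := by
  have hU : ((W * diagonal (fun k => Complex.exp (-(Complex.I * t) * E k)) * Wᴴ)) *ᵥ ψ.ofLp =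
      W *ᵥ fun k => Complex.exp (-(Complex.I * t) * E k) * (Wᴴ *ᵥ ψ.ofLp) k := by
    rw [← mulVec_mulVec, ← mulVec_mulVec]
    congr 1
    ext k
    rw [mulVec_diagonal]
  have hUs : W * diagonal (fun k => Complex.exp (Complex.I * t * E k)) * Wᴴ =
      (W * diagonal (fun k => Complex.exp (-(Complex.I * t) * E k)) * Wᴴ)ᴴ := by
    simp only [conjTranspose_mul, conjTranspose_conjTranspose, diagonal_conjTranspose, mul_assoc]
    congr 3
    ext k
    simp [← Complex.exp_conj, mul_assoc]
  rw [evolution, exp_smul_mul_diagonal_mul_conjTranspose hW,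
    exp_smul_mul_diagonal_mul_conjTranspose hW, hUs, ← hU, pureState_eq_vecMulVec,
    mul_vecMulVec, vecMulVec_mul, star_mulVec]

/-- Here `p` is the energy distribution of `ψ`, and the overlap of the initial and evolved states is
its characteristic function. -/
theorem traceDistance_evolution_sq_le {m : Type*} [Fintype m] [DecidableEq m]
    {W : Matrix m m ℂ} (hW : Wᴴ * W = 1) (E : m → ℝ) {ψ : EuclideanSpace ℂ m} (hψ : ‖ψ‖ = 1) :
    ∃ p : m → ℝ, (∀ k, 0 ≤ p k) ∧ ∑ k, p k = 1 ∧ ∀ t : ℝ,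
      traceDistance (evolution (W * diagonal (fun k => (E k : ℂ)) * Wᴴ) (pureState ψ) 0)
        (evolution (W * diagonal (fun k => (E k : ℂ)) * Wᴴ) (pureState ψ) t) ^ 2 ≤
      1 - Complex.normSq (∑ k, (p k : ℂ) * Complex.exp (-(Complex.I * t) * E k)) := by
  have hW' : W * Wᴴ = 1 := mul_eq_one_comm.mp hW
  set χ := Wᴴ *ᵥ ψ.ofLp with hχ
  have hψ1 : star ψ.ofLp ⬝ᵥ ψ.ofLp = 1 := by
    have := EuclideanSpace.inner_eq_star_dotProduct ψ ψ
    rw [dotProduct_comm, ← this, inner_self_eq_norm_sq_to_K, hψ]; simp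
  have hχψ : W *ᵥ χ = ψ.ofLp := by rw [hχ, mulVec_mulVec, hW', one_mulVec]
  have hiso (a b : m → ℂ) : star (W *ᵥ a) ⬝ᵥ (W *ᵥ b) = star a ⬝ᵥ b := by
    rw [star_mulVec, ← dotProduct_mulVec, mulVec_mulVec, hW, one_mulVec]
  have hχ1 : star χ ⬝ᵥ χ = 1 := by rw [← hiso, hχψ, hψ1]
  have hsq (k) : star (χ k) * χ k = (Complex.normSq (χ k) : ℂ) := by
    rw [← Complex.mul_conj, mul_comm]; rfl
  refine ⟨fun k => Complex.normSq (χ k), fun k => Complex.normSq_nonneg _, ?_, fun t => ?_⟩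
  · have : (∑ k, (Complex.normSq (χ k) : ℂ)) = 1 := by
      rw [← hχ1]; exact Finset.sum_congr rfl fun k _ => (hsq k).symm
    exact_mod_cast this
  · rw [evolution_zero, evolution_pureState_eq hW, pureState_eq_vecMulVec]
    have hph (k) : star (Complex.exp (-(Complex.I * t) * E k)) *
        Complex.exp (-(Complex.I * t) * E k) = 1 := by
      rw [← starRingEnd_apply, ← Complex.exp_conj, ← Complex.exp_add]
      simp
    refine (traceDistance_vecMulVec_sq_le hψ1 ?_).trans_eq ?_
    · rw [hiso, ← hχ1]
      refine Finset.sum_congr rfl fun k _ => ?_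
      simp only [Pi.star_apply, star_mul]
      linear_combination star (χ k) * χ k * hph k
    · nth_rewrite 1 [← hχψ]
      rw [hiso]
      congr 2
      refine Finset.sum_congr rfl fun k _ => ?_
      simp only [Pi.star_apply, ← hsq]
      ring

/-! ### Spectrum of the free Hamiltonian -/

theorem tensorOperator_mul {n d : ℕ} (A B : Fin n → Matrix (Fin d) (Fin d) ℂ) :
    tensorOperator A * tensorOperator B = tensorOperator (fun j => A j * B j) := by
  ext k l
  simp only [tensorOperator, mul_apply, of_apply, ← Finset.prod_mul_distrib]
  rw [Finset.prod_univ_sum, Fintype.piFinset_univ]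

theorem tensorOperator_conjTranspose {n d : ℕ} (A : Fin n → Matrix (Fin d) (Fin d) ℂ) :
    (tensorOperator A)ᴴ = tensorOperator (fun j => (A j)ᴴ) := by
  ext k l
  simp [tensorOperator, conjTranspose_apply]

theorem tensorOperator_diagonal {n d : ℕ} (v : Fin n → Fin d → ℂ) :
    tensorOperator (fun j => diagonal (v j)) = diagonal (fun k => ∏ j, v j (k j)) := by
  ext k l
  simp only [tensorOperator, of_apply]
  by_cases h : k = l
  · subst h; simp
  · obtain ⟨j, hj⟩ := Function.ne_iff.mp h
    rw [diagonal_apply_ne _ h]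
    exact Finset.prod_eq_zero (Finset.mem_univ j) (diagonal_apply_ne _ hj)

theorem tensorOperator_one {n d : ℕ} :
    tensorOperator (fun _ : Fin n => (1 : Matrix (Fin d) (Fin d) ℂ)) = 1 := by
  simp_rw [← diagonal_one, tensorOperator_diagonal]
  simp

theorem freeHamiltonian_diagonal (n : ℕ) {d : ℕ} (v : Fin d → ℂ) :
    freeHamiltonian n (diagonal v) = diagonal (fun k => ∑ j, v (k j)) := by
  have h (i : Fin n) : (fun j => if j = i then diagonal v else (1 : Matrix (Fin d) (Fin d) ℂ)) =
      fun j => diagonal (if j = i then v else 1) := by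
    ext1 j; split_ifs
    · rfl
    · exact diagonal_one.symm
  simp only [freeHamiltonian, h, tensorOperator_diagonal]
  ext k l
  rw [Matrix.sum_apply]
  by_cases hkl : k = l
  · subst hkl
    simp only [diagonal_apply_eq]
    refine Finset.sum_congr rfl fun i _ => ?_
    rw [Finset.prod_eq_single i]
    · simp
    · intro j _ hj; simp [hj]
    · simp
  · simp [diagonal_apply_ne _ hkl]

theorem freeHamiltonian_conj (n : ℕ) {d : ℕ} {V : Matrix (Fin d) (Fin d) ℂ} (hV : Vᴴ * V = 1)
    (D : Matrix (Fin d) (Fin d) ℂ) :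
    freeHamiltonian n (V * D * Vᴴ) =
      tensorOperator (fun _ => V) * freeHamiltonian n D * (tensorOperator fun _ => V)ᴴ := by
  simp only [freeHamiltonian, Finset.mul_sum, Finset.sum_mul, tensorOperator_conjTranspose,
    tensorOperator_mul]
  refine Finset.sum_congr rfl fun i _ => ?_
  congr 1
  ext1 j
  split_ifs
  · rfl
  · rw [mul_one, mul_eq_one_comm.mp hV]

theorem exists_freeHamiltonian_eq (n : ℕ) {d : ℕ} {H : Matrix (Fin d) (Fin d) ℂ}
    (hH : H.IsHermitian) :
    ∃ (W : Matrix (Fin n → Fin d) (Fin n → Fin d) ℂ) (e : Fin d → ℝ), Wᴴ * W = 1 ∧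
      freeHamiltonian n H =
        W * diagonal (fun k => ((∑ j, e (k j) : ℝ) : ℂ)) * Wᴴ := by
  set V : Matrix (Fin d) (Fin d) ℂ := ↑hH.eigenvectorUnitary with hVdef
  have hV : Vᴴ * V = 1 := Unitary.coe_star_mul_self hH.eigenvectorUnitary
  refine ⟨tensorOperator (fun _ => V), hH.eigenvalues, ?_, ?_⟩
  · rw [tensorOperator_conjTranspose, tensorOperator_mul]
    simp only [hV, tensorOperator_one]
  · have hs : H = V * diagonal (fun i => (hH.eigenvalues i : ℂ)) * Vᴴ := by
      conv_lhs => rw [hH.spectral_theorem, Unitary.conjStarAlgAut_apply]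
      rfl
    conv_lhs => rw [hs]
    rw [freeHamiltonian_conj n hV, freeHamiltonian_diagonal]
    simp only [Complex.ofReal_sum]

/-! ### Return estimate -/

/-- The common phase drops out of the modulus, and `cos β ≥ 1 - β²/2` bounds the real part below by
`1 - ε²/2`, whose square is at least `1 - ε²`. -/
theorem one_sub_normSq_sum_exp_le {m : Type*} [Fintype m] {p : m → ℝ} (hp : ∀ k, 0 ≤ p k)
    (hp1 : ∑ k, p k = 1) {z : m → ℂ} {γ : ℝ} {β : m → ℝ} {ε : ℝ} (hε1 : ε ≤ 1)
    (hz : ∀ k, z k = Complex.exp (γ * Complex.I) * Complex.exp (β k * Complex.I))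
    (hβ : ∀ k, |β k| ≤ ε) :
    1 - Complex.normSq (∑ k, (p k : ℂ) * z k) ≤ ε ^ 2 := by
  have hfac : (∑ k, (p k : ℂ) * z k) =
      Complex.exp (γ * Complex.I) * ∑ k, (p k : ℂ) * Complex.exp (β k * Complex.I) := by
    rw [Finset.mul_sum]
    refine Finset.sum_congr rfl fun k _ => ?_
    rw [hz]; ring
  have hγ : Complex.normSq (Complex.exp (γ * Complex.I)) = 1 := by
    rw [Complex.normSq_eq_norm_sq, Complex.norm_exp_ofReal_mul_I]; norm_num
  rw [hfac, Complex.normSq_mul, hγ, one_mul]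
  set S := ∑ k, (p k : ℂ) * Complex.exp (β k * Complex.I)
  have hre : S.re = ∑ k, p k * Real.cos (β k) := by
    simp only [S, Complex.re_sum, Complex.re_ofReal_mul, Complex.exp_ofReal_mul_I_re]
  have hlow : 1 - ε ^ 2 / 2 ≤ S.re := by
    calc 1 - ε ^ 2 / 2 = ∑ k, p k * (1 - ε ^ 2 / 2) := by rw [← Finset.sum_mul, hp1, one_mul]
      _ ≤ _ := by
        rw [hre]
        refine Finset.sum_le_sum fun k _ => mul_le_mul_of_nonneg_left ?_ (hp k)
        have h1 := Real.one_sub_sq_div_two_le_cos (x := β k)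
        have h2 : β k ^ 2 ≤ ε ^ 2 := sq_le_sq' (abs_le.mp (hβ k)).1 (abs_le.mp (hβ k)).2
        linarith
  have hS : S.re ^ 2 ≤ Complex.normSq S := by
    rw [Complex.normSq_apply]; nlinarith [mul_self_nonneg S.im]
  by_cases he : ε < 0
  · have hne : IsEmpty m := ⟨fun k => by linarith [abs_nonneg (β k), hβ k]⟩
    simp at hp1
  · push Not at he
    have h0 : 0 ≤ 1 - ε ^ 2 / 2 := by nlinarith
    nlinarith [pow_le_pow_left₀ h0 hlow 2, sq_nonneg (ε ^ 2)]

/-- Within any arithmetic progression of times, a non-interacting state returns. -/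
theorem exists_traceDistance_evolution_le {d n : ℕ} (hd : 1 ≤ d) (hn : 1 ≤ n)
    {H : Matrix (Fin d) (Fin d) ℂ} (hH : H.IsHermitian)
    {ψ : EuclideanSpace ℂ (Fin n → Fin d)} (hψ : ‖ψ‖ = 1) {ε : ℝ} (hε : 0 < ε) (hε1 : ε ≤ 1)
    (s : ℝ) :
    ∃ k : ℕ, 1 ≤ k ∧ (k : ℝ) ≤ (4 * Real.pi * n / ε) ^ (d - 1) ∧
      traceDistance (evolution (freeHamiltonian n H) (pureState ψ) 0)
        (evolution (freeHamiltonian n H) (pureState ψ) (k * s)) ≤ ε := by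
  obtain ⟨d, rfl⟩ := Nat.exists_eq_add_of_le' hd
  obtain ⟨W, e, hW, hHn⟩ := exists_freeHamiltonian_eq n hH
  obtain ⟨p, hp, hp1, hD⟩ := traceDistance_evolution_sq_le hW (fun k => ∑ j, e (k j)) hψ
  rw [← hHn] at hD
  have hn' : (1 : ℝ) ≤ n := by exact_mod_cast hn
  have hpi := Real.pi_pos
  have hx1 : 1 ≤ 2 * Real.pi * n / ε := by
    rw [le_div_iff₀ hε]
    nlinarith [Real.pi_gt_three]
  -- Accuracy `1 / M` in turns is at most `ε / n` in radians. Since the argument is at least 1,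
  -- rounding up at most doubles it, whence `4π`.
  set M := ⌈2 * Real.pi * n / ε⌉₊ with hMdef
  have hM : 0 < M := Nat.ceil_pos.mpr (by linarith)
  have hM' : (0 : ℝ) < M := by exact_mod_cast hM
  have hMle : (M : ℝ) ≤ 4 * Real.pi * n / ε := by
    have := Nat.ceil_lt_add_one (a := 2 * Real.pi * n / ε) (by linarith)
    have e4 : 4 * Real.pi * n / ε = 2 * (2 * Real.pi * n / ε) := by ring
    rw [e4]; linarith
  have hMge : 2 * Real.pi * n / ε ≤ M := Nat.le_ceil _
  obtain ⟨k, hk1, hk, r, hr⟩ := exists_natCast_mul_sub_intCast_le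
    (fun i : Fin (d + 1 - 1) => s * (e i.succ - e 0) / (2 * Real.pi)) hM
  refine ⟨k, hk1, ?_, ?_⟩
  · calc (k : ℝ) ≤ ((M ^ Fintype.card (Fin (d + 1 - 1)) : ℕ) : ℝ) := by exact_mod_cast hk
      _ ≤ _ := by
        rw [Fintype.card_fin]; push_cast
        exact pow_le_pow_left₀ hM'.le hMle _
  · have hphase : ∃ q : Fin (d + 1) → ℤ, ∀ i,
        |k * s * (e i - e 0) - 2 * Real.pi * q i| ≤ ε / n := by
      -- The gap of `e 0` with itself is zero and needs no approximation, which makes the exponent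
      -- `d - 1`.
      refine ⟨Fin.cons 0 r, fun i => ?_⟩
      refine Fin.cases ?_ (fun i => ?_) i
      · simp only [sub_self, mul_zero, Fin.cons_zero, Int.cast_zero, abs_zero]; positivity
      · rw [Fin.cons_succ]
        have e1 : k * s * (e i.succ - e 0) - 2 * Real.pi * r i =
            2 * Real.pi * (k * (s * (e i.succ - e 0) / (2 * Real.pi)) - r i) := by
          field_simp
        rw [e1, abs_mul, abs_of_pos (by positivity : 0 < 2 * Real.pi)]
        calc _ ≤ 2 * Real.pi * (1 / M) := by
              gcongr
              exact hr i
          _ ≤ ε / n := by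
            rw [mul_one_div, div_le_div_iff₀ hM' (by linarith)]
            rw [div_le_iff₀ hε] at hMge
            linarith
    obtain ⟨q, hq⟩ := hphase
    refine le_of_sq_le_sq ((hD (k * s)).trans ?_) hε.le
    refine one_sub_normSq_sum_exp_le hp hp1 (γ := -(k * s * (n * e 0)))
      (β := fun l => ∑ j, -(k * s * (e (l j) - e 0) - 2 * Real.pi * q (l j))) hε1 (fun l => ?_)
      (fun l => ?_)
    · rw [← Complex.exp_add, Complex.exp_eq_exp_iff_exists_int]
      refine ⟨-∑ j, q (l j), ?_⟩
      push_cast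
      simp only [Finset.sum_neg_distrib, Finset.sum_sub_distrib, ← Finset.mul_sum, mul_sub,
        Finset.sum_const, Finset.card_univ, Fintype.card_fin, nsmul_eq_mul]
      ring
    · calc _ ≤ ∑ _j : Fin n, ε / n := by
            refine (Finset.abs_sum_le_sum_abs _ _).trans (Finset.sum_le_sum fun j _ => ?_)
            rw [abs_neg]; exact hq (l j)
        _ = ε := by
          rw [Finset.sum_const, Finset.card_univ, Fintype.card_fin, nsmul_eq_mul]
          field_simp

theorem traceDistance_evolution_le_one {d n : ℕ} {H : Matrix (Fin d) (Fin d) ℂ}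
    (hH : H.IsHermitian) {ψ : EuclideanSpace ℂ (Fin n → Fin d)} (hψ : ‖ψ‖ = 1) (t : ℝ) :
    traceDistance (evolution (freeHamiltonian n H) (pureState ψ) 0)
      (evolution (freeHamiltonian n H) (pureState ψ) t) ≤ 1 := by
  obtain ⟨W, e, hW, hHn⟩ := exists_freeHamiltonian_eq n hH
  obtain ⟨p, -, -, hD⟩ := traceDistance_evolution_sq_le hW (fun k => ∑ j, e (k j)) hψ
  rw [← hHn] at hD
  refine le_of_sq_le_sq ((hD t).trans ?_) zero_le_one
  rw [one_pow]
  linarith [Complex.normSq_nonneg (∑ k, (p k : ℂ) *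
    Complex.exp (-(Complex.I * t) * ((∑ j, e (k j) : ℝ) : ℂ)))]

/-- If every arithmetic progression `s, 2s, …` returns to the `ε`-ball within `C` steps, then the
recurrence time is at most `C` times the exit time. -/
theorem recurrenceTime_le_exitTime_mul {X : Type*} {D : X → X → ℝ} {x : ℝ → X} {ε C : ℝ}
    (hC : 0 < C)
    (h : exitTime D x ε ≠ ⊤ → ∀ s : ℝ,
      ∃ k : ℕ, 1 ≤ k ∧ (k : ℝ) ≤ C ∧ D (x 0) (x (k * s)) ≤ ε) :
    recurrenceTime D x ε ≤ exitTime D x ε * (C : EReal) := by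
  by_cases htop : exitTime D x ε = ⊤
  · rw [htop, EReal.top_mul_coe_of_pos hC]
    exact le_top
  have h0 : 0 ≤ exitTime D x ε := by
    refine le_sInf ?_
    rintro _ ⟨t, ⟨ht, -⟩, rfl⟩
    exact EReal.coe_nonneg.mpr ht.le
  obtain ⟨T, hT⟩ : ∃ T : ℝ, exitTime D x ε = T :=
    ⟨_, (EReal.coe_toReal htop (ne_bot_of_le_ne_bot EReal.zero_ne_bot h0)).symm⟩
  have hT0 : 0 ≤ T := by rw [hT] at h0; exact_mod_cast h0
  have key (s : ℝ) (hs : T < s) : recurrenceTime D x ε ≤ ((C * s : ℝ) : EReal) := by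
    obtain ⟨k, hk1, hkC, hk⟩ := h htop s
    have hk1' : (1 : ℝ) ≤ k := by exact_mod_cast hk1
    have hlt : exitTime D x ε < ((k * s : ℝ) : EReal) := by
      rw [hT, EReal.coe_lt_coe_iff]
      nlinarith
    have hle : recurrenceTime D x ε ≤ ((k * s : ℝ) : EReal) := sInf_le ⟨k * s, ⟨hlt, hk⟩, rfl⟩
    exact hle.trans (EReal.coe_le_coe_iff.mpr
      (mul_le_mul_of_nonneg_right hkC (hT0.trans hs.le)))
  -- The infimum need not be attained, so the bound is obtained in the limit of `s` decreasing to
  -- `T`, with `s = z / C`.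
  rw [hT, ← EReal.coe_mul, ← EReal.le_of_forall_lt_iff_le]
  intro z hz
  have hz' : T * C < z := by exact_mod_cast hz
  have := key (z / C) ((lt_div_iff₀ hC).mpr hz')
  rwa [mul_div_cancel₀ _ hC.ne'] at this

/-- `ψ₀` ranges over all unit vectors of `(ℂ^d)^{⊗ n}`, entangled or not; if the trajectory never
leaves the `ε`-neighbourhood, both sides are `⊤`. -/
theorem mainTheorem5 (d n : ℕ) (hd : 1 ≤ d) (hn : 1 ≤ n)
    (H : Matrix (Fin d) (Fin d) ℂ) (hH : H.IsHermitian)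
    (ψ₀ : EuclideanSpace ℂ (Fin n → Fin d)) (hψ₀ : ‖ψ₀‖ = 1)
    (ε : ℝ) (hε : 0 < ε) :
    recurrenceTime traceDistance (evolution (freeHamiltonian n H) (pureState ψ₀)) ε ≤
      exitTime traceDistance (evolution (freeHamiltonian n H) (pureState ψ₀)) ε *
        (((4 * Real.pi * (n : ℝ) / ε) ^ (d - 1) : ℝ) : EReal) := by

  refine recurrenceTime_le_exitTime_mul (by positivity) fun htop s => ?_
  -- Trace distance never exceeds 1, so for `ε > 1` the exit time would be `⊤`.
  have hε1 : ε ≤ 1 := by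
    by_contra hlt
    refine htop ?_
    rw [exitTime, sInf_eq_top]
    rintro _ ⟨t, ht, rfl⟩
    exact absurd (ht.2.trans (traceDistance_evolution_le_one hH hψ₀ t)) hlt
  exact exists_traceDistance_evolution_le hd hn hH hψ₀ hε hε1 s
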